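/- **Setting.** Let $G$ be a countable group with identity $e$, and let $\mu$ be a probability measure on $G$ whose support generates $G$. Let $X_1,X_2,\dots$ be the coordinates on the product probability space $(\Omega,\mathbb P)=(G^{\mathbb N},\mu^{\mathbb N})$, so that they are i.i.d. with law $\mu$, and let $\theta(\omega_1,\omega_2,\dots)=(\omega_2,\omega_3,\dots)$ be the time shift. Put $S_0=e$, $S_n=X_1X_2\cdots X_n$, $R_n=\{S_0,\dots,S_n\}$ and $R_\infty=\bigcup_n R_n$. Subsets of $G$ are viewed as points of $\{0,1\}^G$ with the product $\sigma$-algebra. Let $$\mathcal G_n=\sigma(R_j,S_j:\ j\ge n),\qquad \mathcal G_\infty=\bigcap_{n\ge 0}\mathcal G_n,$$ so $\mathcal G_\infty$ is the tail $\sigma$-algebra of $(R_n,S_n)$. For a discrete random element $Y$ (one that almost surely takes values in a countable set) let $H(Y)=-\sum_y\mathbb P(Y=y)\ln\mathbb P(Y=y)$, with $0\ln 0=0$; for non-discrete $Y$ let $H(Y)=\infty$. For a $\sigma$-algebra $\mathcal A$ of events let $H(Y\mid\mathcal A)$ be the $\mathbb P$-mean over $\omega$ of the entropy of $Y$ under the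 regular conditional probability $\mathbb P(\,\cdot\mid\mathcal A)(\omega)$. **Theorem.** Assume $0<H(X_1)<\infty$. Then $H(R_n)<\infty$ for all $n$, and the limit $h_R(\mu):=\lim_{n\to\infty}H(R_n)/n$ exists and is finite. Moreover, for every integer $k\ge 1$, the entropies $H(X_1,\dots,X_k)$ and $H(X_1,\dots,X_k,\,R_\infty\circ\theta^k\mid\mathcal G_\infty)$ are finite, and $$h_R(\mu)=\frac1k\Big[H(X_1,\dots,X_k)-H\big(X_1,\dots,X_k,\ R_\infty\circ\theta^k\ \big|\ \mathcal G_\infty\big)\Big].$$ -/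

import Mathlib

open MeasureTheory ProbabilityTheory Filter Topology
open scoped ENNReal

namespace RangeEntropy

section Entropy

open Classical in
/-- Shannon entropy of the random element `Y` under the probability measure `P`:
`-∑ y, P(Y = y) ln P(Y = y)` (with `0 ln 0 = 0`) if `Y` is discrete, that is, if it takes its
values almost surely in a countable set; `∞` if `Y` is not discrete. -/
noncomputable def entropy {Ω E : Type*} [MeasurableSpace Ω] (P : Measure Ω) (Y : Ω → E) : ℝ≥0∞ :=
  if ∃ C : Set E, C.Countable ∧ P (Y ⁻¹' Cᶜ) = 0 then
    ∑' y : E, ENNReal.ofReal (Real.negMulLog (P (Y ⁻¹' {y})).toReal)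
  else ∞

/-- Conditional entropy `H(Y | m)` with respect to a sub-σ-algebra `m`: the mean, over `ω`, of
the entropy of `Y` under the regular conditional probability `P(· | m)(ω)`. -/
noncomputable def condEntropy {Ω E : Type*} (m : MeasurableSpace Ω) [mΩ : MeasurableSpace Ω]
    [StandardBorelSpace Ω] (P : Measure Ω) [IsFiniteMeasure P] (Y : Ω → E) : ℝ≥0∞ :=
  ∫⁻ ω, entropy (condExpKernel P m ω) Y ∂P

end Entropy

section Walk

variable {G : Type*} [Group G]

/-- The position `S n` of the walk; the coordinate `ω i` is the increment `X_{i+1}(ω)`, so that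
`S 0 = e` and `S n = X_1 X_2 ⋯ X_n`. -/
def walk : ℕ → (ℕ → G) → G
  | 0, _ => 1
  | n + 1, ω => walk n ω * ω n

/-- The random vector `(X_1, …, X_k)`. -/
def increments (k : ℕ) (ω : ℕ → G) : Fin k → G := fun i => ω i

/-- The time shift `(ω_1, ω_2, …) ↦ (ω_2, ω_3, …)`. -/
def shift (ω : ℕ → G) : ℕ → G := fun n => ω (n + 1)

/-- The range `R n = {S 0, …, S n}`. -/
def range (n : ℕ) (ω : ℕ → G) : Set G := {g | ∃ i ≤ n, walk i ω = g}

/-- The total range `R_∞`, the union of all `R n`. -/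
def totalRange (ω : ℕ → G) : Set G := ⋃ n, range n ω

variable [MeasurableSpace G]

/-- The law `μ^ℕ` of the increments on `G^ℕ`. -/
noncomputable def law (μ : Measure G) [IsProbabilityMeasure μ] : Measure (ℕ → G) :=
  Measure.infinitePi (fun _ : ℕ => μ)

instance (μ : Measure G) [IsProbabilityMeasure μ] : IsProbabilityMeasure (law μ) := by
  unfold law; infer_instance

/-- The σ-algebra generated by `(R k, S k)` for all `k ≥ n`. Random subsets of `G` are
measured with the product σ-algebra of `{0,1}^G`, which is Mathlib's σ-algebra on `Set G`. -/
abbrev futureSigma (G : Type*) [Group G] [MeasurableSpace G] (n : ℕ) : MeasurableSpace (ℕ → G) :=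
  ⨆ k ≥ n, MeasurableSpace.comap (fun ω => (range k ω, walk k ω)) inferInstance

/-- The tail σ-algebra of `(R n, S n)`. -/
abbrev tailSigma (G : Type*) [Group G] [MeasurableSpace G] : MeasurableSpace (ℕ → G) :=
  ⨅ n, futureSigma G n

/-- The average entropy of the range, `lim H(R n) / n`. -/
noncomputable def avgRangeEntropy (μ : Measure G) [IsProbabilityMeasure μ] : ℝ :=
  limUnder atTop (fun n : ℕ => (entropy (law μ) (range (G := G) n)).toReal / n)

end Walk

end RangeEntropy

/-!
The idea is to follow how much the entropy of `(R n, S n)` grows when the time increases by `k`.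
As `S n ∈ R n`, this entropy differs from that of `R n` by at most `ln (n + 1)`
(`entropy_stage_le`), so both have the same growth rate.

The triple `(X_1, …, X_k, (R m, S m) ∘ θ^k)` has entropy `H(X_1, …, X_k) + H(R m, S m)` by
independence and stationarity. It determines `(R (k+m), S (k+m))`, so that, by the chain rule
(`entropy_prod_eq_add`),
`H(R (k+m), S (k+m)) - H(R m, S m)
  = H(X_1, …, X_k) - H(X_1, …, X_k, R m ∘ θ^k | R (k+m), S (k+m))`
(`entropy_increments_add_entropy_stage`). It remains to let `m → ∞` in the conditional entropy.

* Given `R (k+m)` and `X_1, …, X_k`, the set `R m ∘ θ^k` is determined by the times `i < k` whose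
  positions `S i` are visited again in `[k, k+m]` (`recover_revisited_assemble`). It may thus be
  replaced by a subset of `{0, …, k-1}` (`visitCode`), which is eventually constant as `m → ∞`
  (`eventually_visitCode_eq`). The same replacement is possible for `R_∞ ∘ θ^k` given the tail
  σ-algebra, because `R_∞` is a tail random set (`condEntropy_eq_tsum`).
* As the increments after time `n` are independent of what precedes, conditioning on `(R n, S n)` is
  the same as conditioning on the σ-algebra `futureSigma G n` (`condProb_ae_eq_condExp`). These
  σ-algebras decrease to the tail σ-algebra, so that the conditional probabilities converge by
  Lévy's downward theorem (`tendsto_eLpNorm_condExp_iInf`), which follows from the convergence of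
  orthogonal projections on decreasing closed subspaces.
* The sum over the values of `visitCode` converges by dominated convergence: by concavity, the term
  of `(x, J)` is at most `-p ln p + p` with `p = P((X_1, …, X_k) = x)`
  (`integral_negMulLog_condExp_le`).

Hence `H(R (k+m), S (k+m)) - H(R m, S m)` converges for every `k`. The case `k = 1` and Cesàro
averaging give the existence of the limit `h` of `H(R n) / n`, and telescoping shows that the limit
for general `k` is `k h`.
-/

namespace RangeEntropy

/-! ### Entropy of discrete random elements -/

section Discrete

/-- The tangent line at `q` dominates the concave function `negMulLog`. -/
theorem negMulLog_le_tangent {p q : ℝ} (hp : 0 ≤ p) (hq : 0 < q) :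
    Real.negMulLog p ≤ -p * Real.log q - p + q := by
  rcases hp.eq_or_lt with rfl | hp
  · simpa using hq.le
  · have h := Real.log_le_sub_one_of_pos (div_pos hq hp)
    rw [Real.log_div hq.ne' hp.ne'] at h
    have h2 := mul_le_mul_of_nonneg_left h hp.le
    have h3 : p * (q / p - 1) = q - p := by field_simp
    rw [h3] at h2
    simp only [Real.negMulLog]
    linarith

variable {Ω α β : Type*} {mΩ : MeasurableSpace Ω} {P : Measure Ω}

theorem entropy_of_countable [Countable α] (P : Measure Ω) (Y : Ω → α) :
    entropy P Y = ∑' y, ENNReal.ofReal (Real.negMulLog (P.real (Y ⁻¹' {y}))) := by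
  rw [entropy, if_pos ⟨Set.univ, Set.countable_univ, by simp⟩]
  rfl

/-- Entropy is invariant under recoding: if `Y` is a function of `Z`, and `Z` is almost surely a
function of the countably-valued `Y`, then `Y` and `Z` have the same entropy. -/
theorem entropy_eq_of_recoding {E : Type*} [Countable α] {Y : Ω → α} {Z : Ω → E}
    (Φ : α → E) (Ψ : E → α) (hΨ : ∀ ω, Ψ (Z ω) = Y ω) (hΦ : ∀ᵐ ω ∂P, Φ (Y ω) = Z ω) :
    entropy P Z = entropy P Y := by
  rw [entropy, if_pos, entropy_of_countable]
  swap
  · refine ⟨Set.range Φ, Set.countable_range Φ, ?_⟩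
    refine measure_mono_null ?_ (ae_iff.1 hΦ)
    intro ω hω h
    exact hω ⟨Y ω, h⟩
  -- The values of `Z` fixed by `Φ ∘ Ψ` carry all the mass, and `Ψ` is injective on them.
  have key : ∀ z, Φ (Ψ z) = z → P (Z ⁻¹' {z}) = P (Y ⁻¹' {Ψ z}) := by
    intro z hz
    refine measure_congr ?_
    filter_upwards [hΦ] with ω hω
    refine propext ⟨fun h : Z ω = z => ?_, fun h : Y ω = Ψ z => ?_⟩
    · change Y ω = Ψ z
      rw [← hΨ, h]
    · change Z ω = z
      rw [← hω, h, hz]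
  have null : ∀ z, Φ (Ψ z) ≠ z → P (Z ⁻¹' {z}) = 0 := by
    intro z hz
    refine measure_mono_null ?_ (ae_iff.1 hΦ)
    intro ω (hω : Z ω = z) h
    apply hz
    rw [← hω, hΨ, h]
  have fixed : ∀ z, ENNReal.ofReal (Real.negMulLog (P (Z ⁻¹' {z})).toReal) ≠ 0 → Φ (Ψ z) = z := by
    intro z hz
    by_contra h
    exact hz (by rw [null z h]; simp)
  symm
  refine tsum_eq_tsum_of_ne_zero_bij (fun z => Ψ z.1) ?_ ?_ ?_
  · intro z w h
    have h' : Ψ z.1 = Ψ w.1 := h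
    refine Subtype.ext ?_
    rw [← fixed z.1 z.2, h', fixed w.1 w.2]
  · intro y hy
    have hy0 : P (Y ⁻¹' {y}) ≠ 0 := by
      intro h
      exact hy (by simp [measureReal_def, h])
    obtain ⟨ω, hω, hω'⟩ : ∃ ω, Y ω = y ∧ Φ (Y ω) = Z ω := by
      by_contra hcon
      push Not at hcon
      exact hy0 (measure_mono_null (fun ω hω => hcon ω hω) (ae_iff.1 hΦ))
    have hfix : Φ (Ψ (Z ω)) = Z ω := by rw [hΨ, hω']
    refine ⟨⟨Z ω, ?_⟩, ?_⟩
    · change ENNReal.ofReal (Real.negMulLog (P (Z ⁻¹' {Z ω})).toReal) ≠ 0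
      rw [key _ hfix, hΨ, hω]
      exact hy
    · change Ψ (Z ω) = y
      rw [hΨ, hω]
  · intro z
    rw [measureReal_def, ← key z.1 (fixed z.1 z.2)]

/-- The elementary conditional probability `P(Y = y | B = b)`; it is `0` if `P(B = b) = 0`. -/
noncomputable def condProb (P : Measure Ω) (Y : Ω → α) (B : Ω → β) (y : α) (b : β) : ℝ :=
  P.real (Y ⁻¹' {y} ∩ B ⁻¹' {b}) / P.real (B ⁻¹' {b})

theorem condProb_nonneg (Y : Ω → α) (B : Ω → β) (y : α) (b : β) : 0 ≤ condProb P Y B y b :=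
  div_nonneg measureReal_nonneg measureReal_nonneg

theorem condProb_le_one [IsFiniteMeasure P] (Y : Ω → α) (B : Ω → β) (y : α) (b : β) :
    condProb P Y B y b ≤ 1 :=
  div_le_one_of_le₀ (measureReal_mono Set.inter_subset_right) measureReal_nonneg

theorem real_mul_condProb [IsFiniteMeasure P] (Y : Ω → α) (B : Ω → β) (y : α) (b : β) :
    P.real (B ⁻¹' {b}) * condProb P Y B y b = P.real (Y ⁻¹' {y} ∩ B ⁻¹' {b}) := by
  rw [condProb]
  by_cases h : P.real (B ⁻¹' {b}) = 0
  · rw [h, zero_mul]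
    exact (le_antisymm (h ▸ measureReal_mono Set.inter_subset_right) measureReal_nonneg).symm
  · field_simp

variable [Countable α] [MeasurableSpace α] [DiscreteMeasurableSpace α]
  [Countable β] [MeasurableSpace β] [DiscreteMeasurableSpace β]

omit [Countable β] [MeasurableSpace β] [DiscreteMeasurableSpace β] in
theorem tsum_ofReal_condProb [IsFiniteMeasure P] {Y : Ω → α} {B : Ω → β} (hY : Measurable Y)
    {b : β} (hb : P.real (B ⁻¹' {b}) ≠ 0) :
    ∑' y, ENNReal.ofReal (condProb P Y B y b) = 1 := by
  have hpos : 0 < P.real (B ⁻¹' {b}) := lt_of_le_of_ne measureReal_nonneg hb.symm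
  have h1 : ∀ y, ENNReal.ofReal (condProb P Y B y b)
      = P (Y ⁻¹' {y} ∩ B ⁻¹' {b}) / P (B ⁻¹' {b}) := by
    intro y
    rw [condProb, ENNReal.ofReal_div_of_pos hpos, ofReal_measureReal, ofReal_measureReal]
  have h2 : ∑' y, P (Y ⁻¹' {y} ∩ B ⁻¹' {b}) = P (B ⁻¹' {b}) := by
    have := tsum_measure_preimage_singleton (μ := P.restrict (B ⁻¹' {b})) (f := Y)
      (Set.countable_univ) (fun y _ => hY (MeasurableSet.singleton y))
    rw [tsum_univ (fun y => P.restrict (B ⁻¹' {b}) (Y ⁻¹' {y}))] at this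
    simp only [Set.preimage_univ, Measure.restrict_apply_univ] at this
    rw [← this]
    exact tsum_congr fun y => (Measure.restrict_apply (hY (MeasurableSet.singleton y))).symm
  simp_rw [h1, div_eq_mul_inv]
  rw [ENNReal.tsum_mul_right, h2]
  refine ENNReal.mul_inv_cancel ?_ (measure_ne_top _ _)
  intro h
  exact hb (by simp [measureReal_def, h])

theorem lintegral_comp_discrete {B : Ω → β} (hB : Measurable B) (f : β → ℝ≥0∞) :
    ∫⁻ ω, f (B ω) ∂P = ∑' b, f b * P (B ⁻¹' {b}) := by
  rw [← lintegral_map (f := f) .of_discrete hB, lintegral_countable']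
  exact tsum_congr fun b => by rw [Measure.map_apply hB (MeasurableSet.singleton b)]

/-- Chain rule: `H(Y, B) = H(B) + H(Y | B)`. -/
theorem entropy_prod_eq_add [IsProbabilityMeasure P] {Y : Ω → α} {B : Ω → β} (hY : Measurable Y)
    (hB : Measurable B) :
    entropy P (fun ω => (Y ω, B ω)) = entropy P B +
      ∑' y, ∫⁻ ω, ENNReal.ofReal (Real.negMulLog (condProb P Y B y (B ω))) ∂P := by
  have hpre : ∀ y b, (fun ω => (Y ω, B ω)) ⁻¹' {(y, b)} = Y ⁻¹' {y} ∩ B ⁻¹' {b} := by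
    intro y b; ext ω; simp
  rw [entropy_of_countable, entropy_of_countable, ENNReal.tsum_prod']
  simp_rw [hpre, ← real_mul_condProb, Real.negMulLog_mul]
  have hadd : ∀ y b, ENNReal.ofReal
      (condProb P Y B y b * Real.negMulLog (P.real (B ⁻¹' {b})) +
        P.real (B ⁻¹' {b}) * Real.negMulLog (condProb P Y B y b)) =
      ENNReal.ofReal (Real.negMulLog (P.real (B ⁻¹' {b}))) *
          ENNReal.ofReal (condProb P Y B y b) +
        ENNReal.ofReal (Real.negMulLog (condProb P Y B y b)) * P (B ⁻¹' {b}) := by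
    intro y b
    have hn := Real.negMulLog_nonneg (measureReal_nonneg (μ := P) (s := B ⁻¹' {b}))
      measureReal_le_one
    have hc := Real.negMulLog_nonneg (condProb_nonneg (P := P) Y B y b) (condProb_le_one Y B y b)
    rw [ENNReal.ofReal_add (mul_nonneg (condProb_nonneg Y B y b) hn)
      (mul_nonneg measureReal_nonneg hc), mul_comm (condProb P Y B y b),
      ENNReal.ofReal_mul hn, mul_comm (P.real _), ENNReal.ofReal_mul hc, ofReal_measureReal]
  simp_rw [hadd, ENNReal.tsum_add]
  congr 1
  swap
  · exact tsum_congr fun y => (lintegral_comp_discrete hB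
      (fun b => ENNReal.ofReal (Real.negMulLog (condProb P Y B y b)))).symm
  rw [ENNReal.tsum_comm]
  refine tsum_congr fun b => ?_
  rw [ENNReal.tsum_mul_left]
  by_cases hb : P.real (B ⁻¹' {b}) = 0
  · simp [hb]
  · rw [tsum_ofReal_condProb hY hb, mul_one]

theorem entropy_comp_le [IsProbabilityMeasure P] {Y : Ω → α} (hY : Measurable Y) (f : α → β) :
    entropy P (fun ω => f (Y ω)) ≤ entropy P Y := by
  have h : entropy P (fun ω => (Y ω, f (Y ω))) = entropy P Y :=
    entropy_eq_of_recoding (fun y => (y, f y)) Prod.fst (fun _ => rfl) (ae_of_all _ fun _ => rfl)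
  have hf : Measurable fun ω => f (Y ω) := (Measurable.of_discrete (f := f)).comp hY
  rw [← h, entropy_prod_eq_add hY hf]
  exact le_self_add

theorem entropy_prod_of_indepFun [IsProbabilityMeasure P] {Y : Ω → α} {B : Ω → β}
    (hY : Measurable Y) (hB : Measurable B) (h : IndepFun Y B P) :
    entropy P (fun ω => (Y ω, B ω)) = entropy P Y + entropy P B := by
  rw [entropy_prod_eq_add hY hB, add_comm, entropy_of_countable P Y]
  congr 1
  refine tsum_congr fun y => ?_
  have hae : ∀ᵐ ω ∂P, P (B ⁻¹' {B ω}) ≠ 0 := by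
    rw [ae_iff]
    simp only [not_not]
    have : {ω | P (B ⁻¹' {B ω}) = 0} = ⋃ b ∈ {b | P (B ⁻¹' {b}) = 0}, B ⁻¹' {b} := by
      ext ω; simp
    rw [this]
    exact (measure_biUnion_null_iff (Set.to_countable _)).2 fun b hb => hb
  rw [lintegral_congr_ae (g := fun _ => ENNReal.ofReal (Real.negMulLog (P.real (Y ⁻¹' {y}))))]
  · simp
  filter_upwards [hae] with ω hω
  have h1 := h.measure_inter_preimage_eq_mul {y} {B ω} (MeasurableSet.singleton _)
    (MeasurableSet.singleton _)
  have h2 : (P (B ⁻¹' {B ω})).toReal ≠ 0 := ENNReal.toReal_ne_zero.2 ⟨hω, measure_ne_top _ _⟩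
  rw [condProb, measureReal_def, h1, ENNReal.toReal_mul, measureReal_def, measureReal_def,
    mul_div_cancel_right₀ _ h2]

/-- If, given `B`, the variable `Y` takes at most `N` values, then `H(Y, B) ≤ H(B) + ln N`. -/
theorem entropy_prod_le_add_log [IsProbabilityMeasure P] {Y : Ω → α} {B : Ω → β}
    (hY : Measurable Y) (hB : Measurable B) (s : β → Finset α) (hs : ∀ ω, Y ω ∈ s (B ω))
    {N : ℕ} (hN : 0 < N) (hcard : ∀ ω, (s (B ω)).card ≤ N) :
    entropy P (fun ω => (Y ω, B ω)) ≤ entropy P B + ENNReal.ofReal (Real.log N) := by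
  rw [entropy_prod_eq_add hY hB]
  gcongr
  have hmeas : ∀ y, Measurable fun ω => ENNReal.ofReal (Real.negMulLog (condProb P Y B y (B ω))) :=
    fun y => (Measurable.of_discrete (f := fun b =>
      ENNReal.ofReal (Real.negMulLog (condProb P Y B y b)))).comp hB
  rw [← lintegral_tsum fun y => (hmeas y).aemeasurable]
  refine (lintegral_mono (g := fun _ => ENNReal.ofReal (Real.log N)) fun ω => ?_).trans (by simp)
  set b := B ω with hbdef
  have hzero : ∀ y ∉ s b, condProb P Y B y b = 0 := by
    intro y hy
    have : Y ⁻¹' {y} ∩ B ⁻¹' {b} = ∅ := by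
      ext ω'
      simp only [Set.mem_inter_iff, Set.mem_preimage, Set.mem_singleton_iff, Set.mem_empty_iff_false,
        iff_false, not_and]
      intro h1 h2
      exact hy (h1 ▸ h2 ▸ hs ω')
    simp [condProb, this]
  change ∑' y, ENNReal.ofReal (Real.negMulLog (condProb P Y B y b)) ≤ ENNReal.ofReal (Real.log N)
  by_cases hb : P.real (B ⁻¹' {b}) = 0
  · simp [condProb, hb]
  have hsum : ∑ y ∈ s b, condProb P Y B y b = 1 := by
    have h1 := tsum_ofReal_condProb hY hb
    rw [tsum_eq_sum (s := s b) (fun y hy => by simp [hzero y hy]),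
      ← ENNReal.ofReal_sum_of_nonneg fun y _ => condProb_nonneg Y B y b] at h1
    exact (ENNReal.ofReal_eq_one).1 h1
  rw [tsum_eq_sum (s := s b) (fun y hy => by simp [hzero y hy]),
    ← ENNReal.ofReal_sum_of_nonneg fun y _ =>
      Real.negMulLog_nonneg (condProb_nonneg Y B y b) (condProb_le_one Y B y b)]
  refine ENNReal.ofReal_le_ofReal ?_
  have hN' : (0 : ℝ) < N := by exact_mod_cast hN
  calc ∑ y ∈ s b, Real.negMulLog (condProb P Y B y b)
      ≤ ∑ y ∈ s b, (condProb P Y B y b * (Real.log N - 1) + (N : ℝ)⁻¹) := by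
        refine Finset.sum_le_sum fun y _ => ?_
        have := negMulLog_le_tangent (condProb_nonneg (P := P) Y B y b) (inv_pos.2 hN')
        rw [Real.log_inv] at this
        linarith
    _ = Real.log N - 1 + (s b).card * (N : ℝ)⁻¹ := by
        rw [Finset.sum_add_distrib, ← Finset.sum_mul, hsum, one_mul, Finset.sum_const, nsmul_eq_mul]
    _ ≤ Real.log N := by
        have h1 : ((s b).card : ℝ) * (N : ℝ)⁻¹ ≤ 1 := by
          rw [← div_eq_mul_inv]
          exact div_le_one_of_le₀ (by exact_mod_cast hcard ω) hN'.le
        linarith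

end Discrete

section Discrete

variable {Ω α β : Type*} {mΩ : MeasurableSpace Ω} {P : Measure Ω}

/-- Two random elements that separate the same points have the same entropy. -/
theorem entropy_eq_of_forall_eq_iff {E : Type*} [Nonempty Ω] [Countable α] {Y : Ω → α} {Z : Ω → E}
    (h : ∀ ω ω', Y ω = Y ω' ↔ Z ω = Z ω') : entropy P Z = entropy P Y := by
  classical
  let Φ : α → E := fun y => Z (Function.invFun Y y)
  let Ψ : E → α := fun z => Y (Function.invFun Z z)
  refine entropy_eq_of_recoding Φ Ψ (fun ω => ?_) (ae_of_all _ fun ω => ?_)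
  · exact (h _ _).2 (Function.invFun_eq ⟨ω, rfl⟩)
  · exact (h _ _).1 (Function.invFun_eq ⟨ω, rfl⟩)

theorem entropy_comp_measurePreserving [Countable α] [MeasurableSpace α]
    [DiscreteMeasurableSpace α] {T : Ω → Ω} (hT : MeasurePreserving T P P) {Y : Ω → α}
    (hY : Measurable Y) : entropy P (fun ω => Y (T ω)) = entropy P Y := by
  rw [entropy_of_countable, entropy_of_countable]
  refine tsum_congr fun y => ?_
  rw [← hT.measureReal_preimage (hY (MeasurableSet.singleton y)).nullMeasurableSet]
  rfl

/-! ### Conditioning on a discrete random element and independent noise -/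

/-- If `T` is independent of `(Y, B)`, then `P(Y = y | B)` integrates to the right value over the
events of `σ(B, T)`. -/
theorem setLIntegral_condProb [IsProbabilityMeasure P] [Countable α] [MeasurableSpace α]
    [DiscreteMeasurableSpace α] [Countable β] [MeasurableSpace β] [DiscreteMeasurableSpace β]
    {γ : Type*} [MeasurableSpace γ] {Y : Ω → α} {B : Ω → β} {T : Ω → γ} (hB : Measurable B)
    (hind : IndepFun (fun ω => (Y ω, B ω)) T P) (y : α) {s : Set Ω} {D : Set (β × γ)}
    (hD : MeasurableSet D) (hs : ∀ ω, ω ∈ s ↔ (B ω, T ω) ∈ D) :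
    ∫⁻ ω in s, ENNReal.ofReal (condProb P Y B y (B ω)) ∂P = P (Y ⁻¹' {y} ∩ s) := by
  have hDb : ∀ b, MeasurableSet (Prod.mk b ⁻¹' D) := fun b => measurable_prodMk_left hD
  have hslice : ∀ b, B ⁻¹' {b} ∩ s = B ⁻¹' {b} ∩ T ⁻¹' (Prod.mk b ⁻¹' D) := by
    intro b
    ext ω
    simp only [hs, Set.mem_inter_iff, Set.mem_preimage, Set.mem_singleton_iff]
    exact and_congr_right fun h => by rw [h]
  have h1 : ∀ b, P (B ⁻¹' {b} ∩ s) = P (B ⁻¹' {b}) * P (T ⁻¹' (Prod.mk b ⁻¹' D)) := by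
    intro b
    rw [hslice]
    exact (hind.comp (φ := Prod.snd) (ψ := id) measurable_snd measurable_id
      ).measure_inter_preimage_eq_mul {b} _ (MeasurableSet.singleton b) (hDb b)
  have h2 : ∀ b, P (Y ⁻¹' {y} ∩ (B ⁻¹' {b} ∩ s))
      = P (Y ⁻¹' {y} ∩ B ⁻¹' {b}) * P (T ⁻¹' (Prod.mk b ⁻¹' D)) := by
    intro b
    have := hind.measure_inter_preimage_eq_mul {(y, b)} _ (MeasurableSet.singleton (y, b)) (hDb b)
    have hpre : (fun ω => (Y ω, B ω)) ⁻¹' {(y, b)} = Y ⁻¹' {y} ∩ B ⁻¹' {b} := by ext ω; simp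
    rw [hpre, Set.inter_assoc] at this
    rw [hslice, this]
  have hpart : P (Y ⁻¹' {y} ∩ s) = ∑' b, P (Y ⁻¹' {y} ∩ (B ⁻¹' {b} ∩ s)) := by
    have := lintegral_comp_discrete (P := P.restrict (Y ⁻¹' {y} ∩ s)) hB (fun _ => 1)
    simp only [lintegral_const, Measure.restrict_apply_univ, one_mul] at this
    rw [this]
    refine tsum_congr fun b => ?_
    rw [Measure.restrict_apply (hB (MeasurableSet.singleton b)), Set.inter_left_comm]
  rw [lintegral_comp_discrete hB (fun b => ENNReal.ofReal (condProb P Y B y b)), hpart]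
  refine tsum_congr fun b => ?_
  rw [Measure.restrict_apply (hB (MeasurableSet.singleton b)), h1, h2, ← mul_assoc]
  congr 1
  rw [← ofReal_measureReal (μ := P) (s := B ⁻¹' {b}),
    ← ENNReal.ofReal_mul (condProb_nonneg _ _ _ _), mul_comm, real_mul_condProb,
    ofReal_measureReal]

/-- Markov property: if `T` is independent of `(Y, B)` and `m` lies between `σ(B)` and `σ(B, T)`,
then conditioning `Y` on `m` is the same as conditioning it on `B`. -/
theorem condProb_ae_eq_condExp [IsProbabilityMeasure P] [Countable α] [MeasurableSpace α]
    [DiscreteMeasurableSpace α] [Countable β] [MeasurableSpace β] [DiscreteMeasurableSpace β]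
    {γ : Type*} [MeasurableSpace γ] {Y : Ω → α} {B : Ω → β} {T : Ω → γ}
    (hY : Measurable Y) (hB : Measurable B) (hT : Measurable T)
    (hind : IndepFun (fun ω => (Y ω, B ω)) T P) {m : MeasurableSpace Ω} (hBm : Measurable[m] B)
    (hm : m ≤ MeasurableSpace.comap (fun ω => (B ω, T ω)) inferInstance) (y : α) :
    (fun ω => condProb P Y B y (B ω)) =ᵐ[P] P⟦Y ⁻¹' {y} | m⟧ := by
  have hm0 : m ≤ mΩ := hm.trans (hB.prodMk hT).comap_le
  have hYy : MeasurableSet[mΩ] (Y ⁻¹' {y}) := hY (MeasurableSet.singleton y)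
  have hgm : Measurable[m] fun ω => condProb P Y B y (B ω) :=
    (Measurable.of_discrete (f := fun b => condProb P Y B y b)).comp hBm
  have hg0 : Measurable[mΩ] fun ω => condProb P Y B y (B ω) := hgm.mono hm0 le_rfl
  have hgint : Integrable (fun ω => condProb P Y B y (B ω)) P := by
    refine Integrable.of_bound (C := 1) hg0.aestronglyMeasurable (ae_of_all _ fun ω => ?_)
    rw [Real.norm_of_nonneg (condProb_nonneg _ _ _ _)]
    exact condProb_le_one _ _ _ _
  refine ae_eq_condExp_of_forall_setIntegral_eq hm0 ((integrable_const 1).indicator hYy)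
    (fun s _ _ => hgint.integrableOn) ?_ hgm.stronglyMeasurable.aestronglyMeasurable
  intro s hs _
  obtain ⟨D, hD, hDs⟩ := hm s hs
  have hl := setLIntegral_condProb hB hind y hD (s := s) fun ω => by rw [← hDs]; rfl
  have h1 : ∫ ω in s, condProb P Y B y (B ω) ∂P = P.real (Y ⁻¹' {y} ∩ s) := by
    have hnn : 0 ≤ᵐ[P.restrict s] fun ω => condProb P Y B y (B ω) :=
      ae_of_all _ fun ω => condProb_nonneg Y B y (B ω)
    have hsm : AEStronglyMeasurable[mΩ] (fun ω => condProb P Y B y (B ω)) (P.restrict s) :=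
      hg0.aestronglyMeasurable
    rw [integral_eq_lintegral_of_nonneg_ae hnn hsm, hl, measureReal_def]
  have h2 : ∫ ω in s, (Y ⁻¹' {y}).indicator (fun _ => (1 : ℝ)) ω ∂P = P.real (Y ⁻¹' {y} ∩ s) := by
    rw [integral_indicator_const _ hYy, measureReal_restrict_apply hYy, smul_eq_mul, mul_one]
  exact h1.trans h2.symm

end Discrete

/-! ### Convergence of conditional expectations along decreasing σ-algebras -/

section ReverseMartingale

theorem tendsto_starProjection_iInf {E : Type*} [NormedAddCommGroup E] [InnerProductSpace ℝ E]
    [CompleteSpace E] (U : ℕ → Submodule ℝ E) [∀ n, (U n).HasOrthogonalProjection]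
    [(⨅ n, U n).HasOrthogonalProjection] (hU : Antitone U) (x : E) :
    Tendsto (fun n => (U n).starProjection x) atTop (𝓝 ((⨅ n, U n).starProjection x)) := by
  have hmono : Monotone fun n => (U n)ᗮ := fun i j hij => Submodule.orthogonal_le (hU hij)
  have h := Submodule.starProjection_tendsto_closure_iSup (fun n => (U n)ᗮ) hmono x
  have hV : (⨆ n, (U n)ᗮ).topologicalClosure = (⨅ n, U n)ᗮ := by
    rw [← Submodule.orthogonal_orthogonal_eq_closure, ← Submodule.iInf_orthogonal]
    simp_rw [Submodule.orthogonal_orthogonal]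
  simp only [hV, Submodule.starProjection_orthogonal] at h
  have h2 := h.const_sub x
  simpa using h2

variable {Ω : Type*} {m0 : MeasurableSpace Ω} {P : Measure Ω}

/-- A function that is a.e. equal to an `m n`-measurable one for every `n` is a.e. equal to one
measurable with respect to `⨅ n, m n`. -/
theorem aestronglyMeasurable_iInf {m : ℕ → MeasurableSpace Ω} (hm : Antitone m) {f : Ω → ℝ}
    (hf : ∀ n, AEStronglyMeasurable[m n] f P) : AEStronglyMeasurable[⨅ n, m n] f P := by
  let g : ℕ → Ω → ℝ := fun n => (hf n).mk f
  have hg : ∀ n, Measurable[m n] (g n) := fun n => (hf n).stronglyMeasurable_mk.measurable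
  refine ⟨fun ω => limsup (fun n => g n ω) atTop, ?_, ?_⟩
  · -- The limit superior does not depend on the first `N` functions.
    refine Measurable.stronglyMeasurable ?_
    have key : ∀ N, Measurable[m N] fun ω => limsup (fun n => g n ω) atTop := by
      intro N
      have heq : (fun ω => limsup (fun n => g n ω) atTop)
          = fun ω => limsup (fun n => g (n + N) ω) atTop := by
        funext ω
        exact (limsup_nat_add (fun n => g n ω) N).symm
      rw [heq]
      exact Measurable.limsup fun n => (hg (n + N)).mono (hm (Nat.le_add_left N n)) le_rfl
    intro s hs
    rw [MeasurableSpace.measurableSet_iInf]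
    exact fun N => key N hs
  · have hae : ∀ᵐ ω ∂P, ∀ n, f ω = g n ω := ae_all_iff.2 fun n => (hf n).ae_eq_mk
    filter_upwards [hae] with ω hω
    simp [← hω]

theorem iInf_lpMeas {m : ℕ → MeasurableSpace Ω} (hm : Antitone m) :
    ⨅ n, lpMeas ℝ ℝ (m n) 2 P = lpMeas ℝ ℝ (⨅ n, m n) 2 P := by
  ext f
  simp only [Submodule.mem_iInf, mem_lpMeas_iff_aestronglyMeasurable]
  exact ⟨aestronglyMeasurable_iInf hm, fun h n => h.mono (iInf_le m n)⟩

/-- Lévy's downward theorem in `L²`. -/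
theorem tendsto_eLpNorm_condExp_iInf [IsProbabilityMeasure P] {m : ℕ → MeasurableSpace Ω}
    (hm : Antitone m) (hle : ∀ n, m n ≤ m0) {f : Ω → ℝ} (hf : MemLp f 2 P) :
    Tendsto (fun n => eLpNorm (P[f | m n] - P[f | ⨅ n, m n]) 2 P) atTop (𝓝 0) := by
  have hle' : ⨅ n, m n ≤ m0 := (iInf_le m 0).trans (hle 0)
  have : ∀ n, Fact (m n ≤ m0) := fun n => ⟨hle n⟩
  have : Fact (⨅ n, m n ≤ m0) := ⟨hle'⟩
  have : (⨅ n, lpMeas ℝ ℝ (m n) 2 P).HasOrthogonalProjection := by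
    rw [iInf_lpMeas hm]; infer_instance
  have hanti : Antitone fun n => lpMeas ℝ ℝ (m n) 2 P := by
    intro i j hij g hg
    rw [mem_lpMeas_iff_aestronglyMeasurable] at hg ⊢
    exact hg.mono (hm hij)
  have h := tendsto_starProjection_iInf (fun n => lpMeas ℝ ℝ (m n) 2 P) hanti (hf.toLp f)
  simp only [iInf_lpMeas hm] at h
  have h' : Tendsto (fun n => ((condExpL2 ℝ ℝ (hle n) (hf.toLp f) : Lp ℝ 2 P))) atTop
      (𝓝 ((condExpL2 ℝ ℝ hle' (hf.toLp f) : Lp ℝ 2 P))) := h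
  rw [Lp.tendsto_Lp_iff_tendsto_eLpNorm'] at h'
  refine h'.congr fun n => eLpNorm_congr_ae ?_
  exact (hf.condExpL2_ae_eq_condExp (𝕜 := ℝ) (hle n)).sub
    (hf.condExpL2_ae_eq_condExp (𝕜 := ℝ) hle')

theorem condExp_indicator_mem_Icc [IsProbabilityMeasure P] {m : MeasurableSpace Ω} (hm : m ≤ m0)
    {A : Set Ω} (hA : MeasurableSet[m0] A) :
    ∀ᵐ ω ∂P, (P⟦A | m⟧) ω ∈ Set.Icc (0 : ℝ) 1 := by
  have hint : Integrable (A.indicator fun _ => (1 : ℝ)) P := (integrable_const 1).indicator hA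
  have h0 : 0 ≤ᵐ[P] P⟦A | m⟧ :=
    condExp_nonneg (ae_of_all _ fun ω => Set.indicator_nonneg (fun _ _ => zero_le_one) ω)
  have h1 : P⟦A | m⟧ ≤ᵐ[P] P[(fun _ => (1 : ℝ)) | m] :=
    condExp_mono hint (integrable_const 1)
      (ae_of_all _ fun ω => Set.indicator_le_self' (fun _ _ => zero_le_one) ω)
  rw [condExp_const hm] at h1
  filter_upwards [h0, h1] with ω hω hω' using ⟨hω, hω'⟩

theorem integrable_negMulLog_condExp [IsProbabilityMeasure P] {m : MeasurableSpace Ω} (hm : m ≤ m0)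
    {A : Set Ω} (hA : MeasurableSet[m0] A) :
    Integrable (fun ω => Real.negMulLog ((P⟦A | m⟧) ω)) P := by
  refine Integrable.of_bound (C := 1) (Real.continuous_negMulLog.comp_aestronglyMeasurable
    integrable_condExp.aestronglyMeasurable) ?_
  filter_upwards [condExp_indicator_mem_Icc hm hA] with ω hω
  rw [Real.norm_of_nonneg (Real.negMulLog_nonneg hω.1 hω.2)]
  linarith [Real.negMulLog_le_one_sub_self hω.1, hω.1]

theorem integral_negMulLog_condExp_nonneg [IsProbabilityMeasure P] {m : MeasurableSpace Ω}
    (hm : m ≤ m0) {A : Set Ω} (hA : MeasurableSet[m0] A) :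
    0 ≤ ∫ ω, Real.negMulLog ((P⟦A | m⟧) ω) ∂P := by
  refine integral_nonneg_of_ae ?_
  filter_upwards [condExp_indicator_mem_Icc hm hA] with ω hω using
    Real.negMulLog_nonneg hω.1 hω.2

/-- Concavity, in a form that bounds the contribution of an event `A` to a conditional entropy in
terms of the probability of a larger event. -/
theorem integral_negMulLog_condExp_le [IsProbabilityMeasure P] {m : MeasurableSpace Ω}
    (hm : m ≤ m0) {A : Set Ω} (hA : MeasurableSet[m0] A) {q : ℝ} (hq : P.real A ≤ q)
    (hq1 : q ≤ 1) :
    ∫ ω, Real.negMulLog ((P⟦A | m⟧) ω) ∂P ≤ Real.negMulLog q + q := by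
  have hint : Integrable (A.indicator fun _ => (1 : ℝ)) P := (integrable_const 1).indicator hA
  rcases (measureReal_nonneg.trans hq).eq_or_lt with rfl | hq0
  · have hA0 : P A = 0 := (measureReal_eq_zero_iff).1 (le_antisymm hq measureReal_nonneg)
    have h0 : A.indicator (fun _ => (1 : ℝ)) =ᵐ[P] 0 := by
      filter_upwards [measure_eq_zero_iff_ae_notMem.1 hA0] with ω hω
      simp [hω]
    have h1 : P⟦A | m⟧ =ᵐ[P] 0 := (condExp_congr_ae h0).trans (by rw [condExp_zero])
    rw [integral_congr_ae (g := fun _ => (0 : ℝ))]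
    · simp
    · filter_upwards [h1] with ω hω
      simp [hω]
  have hmean : ∫ ω, (P⟦A | m⟧) ω ∂P = P.real A := by
    rw [integral_condExp hm, integral_indicator_const _ hA]; simp
  have hc : Integrable (P⟦A | m⟧) P := integrable_condExp
  calc ∫ ω, Real.negMulLog ((P⟦A | m⟧) ω) ∂P
      ≤ ∫ ω, ((P⟦A | m⟧) ω * (-Real.log q - 1) + q) ∂P := by
        refine integral_mono_ae (integrable_negMulLog_condExp hm hA)
          ((hc.mul_const _).add (integrable_const q)) ?_
        filter_upwards [condExp_indicator_mem_Icc hm hA] with ω hω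
        have := negMulLog_le_tangent hω.1 hq0
        linarith
    _ = P.real A * (-Real.log q) + (q - P.real A) := by
        rw [integral_add (hc.mul_const _) (integrable_const q), integral_mul_const, hmean]
        simp
        ring
    _ ≤ Real.negMulLog q + q := by
        have h0 := measureReal_nonneg (μ := P) (s := A)
        have hl := Real.log_nonpos hq0.le hq1
        have := mul_le_mul_of_nonneg_right hq (neg_nonneg.2 hl)
        simp only [Real.negMulLog]
        linarith

/-- If the events `A n` converge pointwise to `A'` and the σ-algebras `m n` decrease, then the mean
of `negMulLog` of the conditional probabilities converges. -/
theorem tendsto_integral_negMulLog_condExp [IsProbabilityMeasure P] {m : ℕ → MeasurableSpace Ω}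
    (hm : Antitone m) (hle : ∀ n, m n ≤ m0) {A : ℕ → Set Ω} {A' : Set Ω}
    (hA : ∀ n, MeasurableSet (A n)) (hA' : MeasurableSet A')
    (hlim : ∀ ω, ∀ᶠ n in atTop, (ω ∈ A n ↔ ω ∈ A')) :
    Tendsto (fun n => ∫ ω, Real.negMulLog ((P⟦A n | m n⟧) ω) ∂P) atTop
      (𝓝 (∫ ω, Real.negMulLog ((P⟦A' | ⨅ n, m n⟧) ω) ∂P)) := by
  have hle' : ⨅ n, m n ≤ m0 := (iInf_le m 0).trans (hle 0)
  let f : ℕ → Ω → ℝ := fun n => (A n).indicator fun _ => 1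
  let f' : Ω → ℝ := A'.indicator fun _ => 1
  have hf : ∀ n, Integrable (f n) P := fun n => (integrable_const 1).indicator (hA n)
  have hf' : Integrable f' P := (integrable_const 1).indicator hA'
  have hff : Tendsto (fun n => eLpNorm (f n - f') 1 P) atTop (𝓝 0) := by
    simp_rw [eLpNorm_one_eq_lintegral_enorm]
    have := tendsto_lintegral_of_dominated_convergence' (μ := P)
      (F := fun n ω => ‖(f n - f') ω‖ₑ) (f := fun _ => 0) (fun _ => 1)
      (fun n => ((hf n).sub hf').aestronglyMeasurable.enorm)
      (fun n => ae_of_all _ fun ω => ?_) (by simp) (ae_of_all _ fun ω => ?_)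
    · simpa using this
    · by_cases h1 : ω ∈ A n <;> by_cases h2 : ω ∈ A' <;> simp [f, f', h1, h2]
    · refine tendsto_const_nhds.congr' ?_
      filter_upwards [hlim ω] with n hn
      by_cases h : ω ∈ A' <;> simp [f, f', h, hn]
  have hrev : Tendsto (fun n => eLpNorm (P[f' | m n] - P[f' | ⨅ n, m n]) 1 P) atTop (𝓝 0) := by
    have hL2 : MemLp f' 2 P := memLp_indicator_const 2 hA' 1 (Or.inr (measure_ne_top _ _))
    refine tendsto_of_tendsto_of_tendsto_of_le_of_le tendsto_const_nhds
      (tendsto_eLpNorm_condExp_iInf hm hle hL2) (fun _ => zero_le) fun n => ?_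
    exact eLpNorm_le_eLpNorm_of_exponent_le one_le_two
      (integrable_condExp.sub integrable_condExp).aestronglyMeasurable
  have hL1 : Tendsto (fun n => eLpNorm (P[f n | m n] - P[f' | ⨅ n, m n]) 1 P) atTop (𝓝 0) := by
    refine tendsto_of_tendsto_of_tendsto_of_le_of_le tendsto_const_nhds
      (by simpa using hff.add hrev) (fun _ => zero_le) fun n => ?_
    have hsplit : P[f n | m n] - P[f' | ⨅ n, m n]
        = (P[f n | m n] - P[f' | m n]) + (P[f' | m n] - P[f' | ⨅ n, m n]) := by abel
    change eLpNorm (P[f n | m n] - P[f' | ⨅ n, m n]) 1 P ≤ _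
    rw [hsplit]
    refine (eLpNorm_add_le (integrable_condExp.sub integrable_condExp).aestronglyMeasurable
      (integrable_condExp.sub integrable_condExp).aestronglyMeasurable le_rfl).trans ?_
    gcongr
    rw [← eLpNorm_congr_ae (condExp_sub (hf n) hf' (m n))]
    exact eLpNorm_condExp_le_eLpNorm _ le_rfl
  have hmeas : TendstoInMeasure P (fun n => P[f n | m n]) atTop (P[f' | ⨅ n, m n]) :=
    tendstoInMeasure_of_tendsto_eLpNorm one_ne_zero
      (fun n => integrable_condExp.aestronglyMeasurable) integrable_condExp.aestronglyMeasurable hL1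
  refine tendsto_of_subseq_tendsto fun ns hns => ?_
  obtain ⟨ms, -, hms⟩ := (hmeas.comp hns).exists_seq_tendsto_ae
  refine ⟨ms, ?_⟩
  refine tendsto_integral_of_dominated_convergence (fun _ => 1)
    (fun n => (integrable_negMulLog_condExp (hle _) (hA _)).aestronglyMeasurable)
    (integrable_const 1) (fun n => ?_) ?_
  · filter_upwards [condExp_indicator_mem_Icc (P := P) (hle (ns (ms n))) (hA (ns (ms n)))] with ω hω
    rw [Real.norm_of_nonneg (Real.negMulLog_nonneg hω.1 hω.2)]
    linarith [Real.negMulLog_le_one_sub_self hω.1, hω.1]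
  · filter_upwards [hms] with ω hω
    exact (Real.continuous_negMulLog.tendsto _).comp hω

end ReverseMartingale

/-! ### The walk and its range -/

section Walk

variable {G : Type*} [Group G]

omit [Group G] in
theorem shift_iterate (k : ℕ) (ω : ℕ → G) (n : ℕ) : shift^[k] ω n = ω (n + k) := by
  induction k generalizing n with
  | zero => rfl
  | succ k ih =>
    rw [Function.iterate_succ_apply', shift, ih]
    congr 1
    omega

theorem walk_congr {n : ℕ} {ω ω' : ℕ → G} (h : ∀ i < n, ω i = ω' i) : walk n ω = walk n ω' := by
  induction n with
  | zero => rfl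
  | succ n ih => rw [walk, walk, ih fun i hi => h i (by omega), h n (by omega)]

theorem walk_add (k m : ℕ) (ω : ℕ → G) : walk (k + m) ω = walk k ω * walk m (shift^[k] ω) := by
  induction m with
  | zero => simp [walk]
  | succ m ih => rw [← add_assoc, walk, walk, ih, shift_iterate, mul_assoc, add_comm m k]

/-- The sequence of increments that starts with `x` and is `1` afterwards. -/
def prolong {k : ℕ} (x : Fin k → G) : ℕ → G := fun i => if h : i < k then x ⟨i, h⟩ else 1

theorem prolong_increments {k i : ℕ} (h : i < k) (ω : ℕ → G) :
    prolong (increments k ω) i = ω i := by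
  simp [prolong, increments, h]

theorem walk_prolong_increments {k i : ℕ} (h : i ≤ k) (ω : ℕ → G) :
    walk i (prolong (increments k ω)) = walk i ω :=
  walk_congr fun _ hj => prolong_increments (hj.trans_le h) ω

theorem range_congr {n : ℕ} {ω ω' : ℕ → G} (h : ∀ i < n, ω i = ω' i) :
    range n ω = range n ω' := by
  ext g
  refine exists_congr fun i => and_congr_right fun hi => ?_
  rw [walk_congr fun j hj => h j (hj.trans_le hi)]

theorem mem_totalRange {ω : ℕ → G} {g : G} : g ∈ totalRange ω ↔ ∃ i, walk i ω = g := by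
  simp only [totalRange, Set.mem_iUnion]
  exact ⟨fun ⟨_, i, _, h⟩ => ⟨i, h⟩, fun ⟨i, h⟩ => ⟨i, i, le_rfl, h⟩⟩

theorem range_mono (ω : ℕ → G) : Monotone fun n => range n ω :=
  fun _ _ hab _ ⟨i, hi, h⟩ => ⟨i, hi.trans hab, h⟩

/-- The set visited by a walk whose first `k` increments are `x` and whose subsequent trajectory,
translated so as to start at the identity, visits `A`. -/
def assemble {k : ℕ} (x : Fin k → G) (A : Set G) : Set G :=
  {g | (∃ i < k, walk i (prolong x) = g) ∨ ∃ a ∈ A, walk k (prolong x) * a = g}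

open Classical in
/-- The times `i < k` whose positions are visited again at time `k` or later, when the first `k`
increments are `x` and the translated subsequent trajectory visits `A`. -/
noncomputable def revisited {k : ℕ} (x : Fin k → G) (A : Set G) : Finset (Fin k) :=
  {i | ∃ a ∈ A, walk k (prolong x) * a = walk i (prolong x)}

/-- The set `A` as a function of `x`, of the set `J = revisited x A` and of `R = assemble x A`. -/
def recover {k : ℕ} (x : Fin k → G) (J : Finset (Fin k)) (R : Set G) : Set G :=
  {g | (walk k (prolong x) * g ∈ R ∧ ∀ i < k, walk i (prolong x) ≠ walk k (prolong x) * g) ∨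
    ∃ i ∈ J, walk i (prolong x) = walk k (prolong x) * g}

theorem recover_revisited_assemble {k : ℕ} (x : Fin k → G) (A : Set G) :
    recover x (revisited x A) (assemble x A) = A := by
  ext g
  simp only [recover, revisited, assemble, Set.mem_ofPred_eq, Finset.mem_filter, Finset.mem_univ,
    true_and]
  constructor
  · rintro (⟨⟨i, hi, h⟩ | ⟨a, ha, h⟩, hne⟩ | ⟨i, ⟨a, ha, h⟩, h'⟩)
    · exact absurd h (hne i hi)
    · rwa [← mul_left_cancel h]
    · rw [h'] at h
      rwa [← mul_left_cancel h]
  · intro hg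
    by_cases h : ∀ i < k, walk i (prolong x) ≠ walk k (prolong x) * g
    · exact Or.inl ⟨Or.inr ⟨g, hg, rfl⟩, h⟩
    · push Not at h
      obtain ⟨i, hi, h⟩ := h
      exact Or.inr ⟨⟨i, hi⟩, ⟨g, hg, h.symm⟩, h⟩

theorem range_add (k m : ℕ) (ω : ℕ → G) :
    range (k + m) ω = assemble (increments k ω) (range m (shift^[k] ω)) := by
  ext g
  constructor
  · rintro ⟨i, hi, h⟩
    rcases lt_or_ge i k with hik | hik
    · exact Or.inl ⟨i, hik, by rw [walk_prolong_increments hik.le, h]⟩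
    · refine Or.inr ⟨walk (i - k) (shift^[k] ω), ⟨i - k, by omega, rfl⟩, ?_⟩
      rw [walk_prolong_increments le_rfl, ← walk_add, Nat.add_sub_cancel' hik, h]
  · rintro (⟨i, hi, h⟩ | ⟨a, ⟨j, hj, rfl⟩, h⟩)
    · exact ⟨i, by omega, by rw [← h, walk_prolong_increments hi.le]⟩
    · exact ⟨k + j, by omega, by rw [← h, walk_prolong_increments le_rfl, walk_add]⟩

theorem totalRange_eq_assemble (k : ℕ) (ω : ℕ → G) :
    totalRange ω = assemble (increments k ω) (totalRange (shift^[k] ω)) := by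
  ext g
  rw [mem_totalRange]
  constructor
  · rintro ⟨i, h⟩
    rcases lt_or_ge i k with hik | hik
    · exact Or.inl ⟨i, hik, by rw [walk_prolong_increments hik.le, h]⟩
    · refine Or.inr ⟨walk (i - k) (shift^[k] ω), mem_totalRange.2 ⟨i - k, rfl⟩, ?_⟩
      rw [walk_prolong_increments le_rfl, ← walk_add, Nat.add_sub_cancel' hik, h]
  · rintro (⟨i, hi, h⟩ | ⟨a, ha, h⟩)
    · exact ⟨i, by rw [← h, walk_prolong_increments hi.le]⟩
    · obtain ⟨j, rfl⟩ := mem_totalRange.1 ha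
      exact ⟨k + j, by rw [← h, walk_prolong_increments le_rfl, walk_add]⟩

open Classical in
/-- The range `R n` as a finite set. -/
noncomputable def finRange (n : ℕ) (ω : ℕ → G) : Finset G :=
  (Finset.range (n + 1)).image fun i => walk i ω

theorem coe_finRange (n : ℕ) (ω : ℕ → G) : (finRange n ω : Set G) = range n ω := by
  ext g
  simp [finRange, range]

theorem finRange_eq_iff {n : ℕ} {ω ω' : ℕ → G} :
    finRange n ω = finRange n ω' ↔ range n ω = range n ω' := by
  rw [← Finset.coe_inj, coe_finRange, coe_finRange]

theorem card_finRange_le (n : ℕ) (ω : ℕ → G) : (finRange n ω).card ≤ n + 1 := by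
  classical exact Finset.card_image_le.trans (Finset.card_range _).le

theorem walk_mem_finRange (n : ℕ) (ω : ℕ → G) : walk n ω ∈ finRange n ω := by
  rw [← Finset.mem_coe, coe_finRange]
  exact ⟨n, le_rfl, rfl⟩

/-- The pair `(R n, S n)`, as an element of a countable type. -/
noncomputable def stage (n : ℕ) (ω : ℕ → G) : Finset G × G := (finRange n ω, walk n ω)

/-- The first `k` increments, together with the times `i < k` whose positions are visited again
during the time interval `[k, k + m]`. -/
noncomputable def visitCode (k m : ℕ) (ω : ℕ → G) : (Fin k → G) × Finset (Fin k) :=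
  (increments k ω, revisited (increments k ω) (range m (shift^[k] ω)))

/-- The first `k` increments, together with the times `i < k` whose positions are visited again
at time `k` or later. -/
noncomputable def totalVisitCode (k : ℕ) (ω : ℕ → G) : (Fin k → G) × Finset (Fin k) :=
  (increments k ω, revisited (increments k ω) (totalRange (shift^[k] ω)))

theorem eventually_visitCode_eq (k : ℕ) (ω : ℕ → G) :
    ∀ᶠ m in atTop, visitCode k m ω = totalVisitCode k ω := by
  -- Each of the finitely many times that are visited again is visited again at a finite time.
  have h : ∀ i : Fin k, ∀ᶠ m in atTop,
      (i ∈ revisited (increments k ω) (range m (shift^[k] ω)) ↔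
        i ∈ revisited (increments k ω) (totalRange (shift^[k] ω))) := by
    intro i
    simp only [revisited, Finset.mem_filter, Finset.mem_univ, true_and]
    by_cases hi : ∃ a ∈ totalRange (shift^[k] ω), walk k (prolong (increments k ω)) * a =
        walk i (prolong (increments k ω))
    · obtain ⟨a, ha, h⟩ := hi
      obtain ⟨n, hn⟩ := Set.mem_iUnion.1 ha
      filter_upwards [eventually_ge_atTop n] with m hm
      exact ⟨fun _ => ⟨a, ha, h⟩, fun _ => ⟨a, range_mono _ hm hn, h⟩⟩
    · refine Eventually.of_forall fun m => ⟨fun ⟨a, ha, h⟩ => ?_, fun h => absurd h hi⟩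
      exact ⟨a, Set.mem_iUnion.2 ⟨m, ha⟩, h⟩
  filter_upwards [eventually_all.2 h] with m hm
  exact Prod.ext rfl (Finset.ext hm)

/-- Both sides encode the same information: the first `k` increments and `(R m, S m) ∘ θ^k`. -/
theorem visitCode_stage_eq_iff (k m : ℕ) (ω ω' : ℕ → G) :
    (visitCode k m ω, stage (k + m) ω) = (visitCode k m ω', stage (k + m) ω') ↔
      (increments k ω, stage m (shift^[k] ω)) = (increments k ω', stage m (shift^[k] ω')) := by
  simp only [visitCode, stage, Prod.mk.injEq, finRange_eq_iff, walk_add]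
  constructor
  · rintro ⟨⟨hx, hJ⟩, hR, hS⟩
    have hk : walk k ω = walk k ω' := by
      rw [← walk_prolong_increments le_rfl, hx, walk_prolong_increments le_rfl]
    refine ⟨hx, ?_, ?_⟩
    · rw [← recover_revisited_assemble (increments k ω) (range m (shift^[k] ω)), ← range_add, hJ,
        hR, hx, range_add, recover_revisited_assemble]
    · rw [hk] at hS
      exact mul_left_cancel hS
  · rintro ⟨hx, hR, hS⟩
    have hk : walk k ω = walk k ω' := by
      rw [← walk_prolong_increments le_rfl, hx, walk_prolong_increments le_rfl]
    refine ⟨⟨hx, by rw [hx, hR]⟩, ?_, by rw [hk, hS]⟩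
    rw [range_add, hx, hR, ← range_add]

theorem stage_congr {n : ℕ} {ω ω' : ℕ → G} (h : ∀ i < n, ω i = ω' i) : stage n ω = stage n ω' :=
  Prod.ext (finRange_eq_iff.2 (range_congr h)) (walk_congr h)

theorem visitCode_congr {k m : ℕ} {ω ω' : ℕ → G} (h : ∀ i < k + m, ω i = ω' i) :
    visitCode k m ω = visitCode k m ω' := by
  have hx : increments k ω = increments k ω' := funext fun i => h i (by omega)
  have hR : range m (shift^[k] ω) = range m (shift^[k] ω') :=
    range_congr fun i hi => by rw [shift_iterate, shift_iterate, h _ (by omega)]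
  rw [visitCode, visitCode, hx, hR]

end Walk

/-! ### Measurability, independence and stationarity -/

section Law

variable {G : Type*} [MeasurableSpace G]

theorem measurable_increments (k : ℕ) : Measurable (increments k : (ℕ → G) → Fin k → G) :=
  measurable_pi_lambda _ fun i => measurable_pi_apply (i : ℕ)

theorem measurePreserving_shift_iterate [Group G] (μ : Measure G) [IsProbabilityMeasure μ] (k : ℕ) :
    MeasurePreserving (shift^[k] : (ℕ → G) → ℕ → G) (law μ) (law μ) := by
  have h : (shift^[k] : (ℕ → G) → ℕ → G) = fun ω n => ω (n + k) :=
    funext fun ω => funext fun n => shift_iterate k ω n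
  rw [h]
  exact ⟨measurable_pi_lambda _ fun n => measurable_pi_apply (n + k),
    Measure.map_infinitePi_infinitePi_of_inj (P := fun _ : ℕ => μ) (add_left_injective k)⟩

theorem indepFun_increments_shift_iterate [Group G] (μ : Measure G) [IsProbabilityMeasure μ]
    (k : ℕ) : IndepFun (increments k) (shift^[k] : (ℕ → G) → ℕ → G) (law μ) := by
  have hi : iIndepFun (fun (i : ℕ) (ω : ℕ → G) => ω i) (law μ) :=
    iIndepFun_infinitePi (P := fun _ : ℕ => μ) (X := fun _ x => x) fun _ => measurable_id
  have hdisj : Disjoint {i : ℕ | i < k} {i | k ≤ i} :=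
    Set.disjoint_left.2 fun i (h1 : i < k) (h2 : k ≤ i) => absurd h1 (not_lt.2 h2)
  have h := indep_iSup_of_disjoint (fun i => (measurable_pi_apply i).comap_le) hi hdisj
  rw [IndepFun_iff_Indep]
  have hcoord : ∀ (S : Set ℕ) (i : ℕ), i ∈ S →
      Measurable[⨆ i ∈ S, MeasurableSpace.comap (fun ω : ℕ → G => ω i) inferInstance]
        fun ω : ℕ → G => ω i := by
    intro S i hi
    exact Measurable.mono (comap_measurable _) (le_iSup₂_of_le i hi le_rfl) le_rfl
  refine indep_of_indep_of_le_left (indep_of_indep_of_le_right h ?_) ?_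
  · refine Measurable.comap_le ?_
    refine @measurable_pi_lambda _ _ _ (_) _ _ fun n => ?_
    simp only [shift_iterate]
    exact hcoord _ _ (Nat.le_add_left k n)
  · refine Measurable.comap_le ?_
    exact @measurable_pi_lambda _ _ _ (_) _ _ fun i => hcoord _ _ i.2

variable [Group G] [Countable G] [DiscreteMeasurableSpace G]

theorem measurable_walk (n : ℕ) : Measurable (walk n : (ℕ → G) → G) := by
  induction n with
  | zero => exact measurable_const
  | succ n ih =>
    exact (Measurable.of_discrete (f := fun p : G × G => p.1 * p.2)).comp
      (ih.prodMk (measurable_pi_apply n))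

theorem measurable_range (n : ℕ) : Measurable (range n : (ℕ → G) → Set G) := by
  refine measurable_set_iff.2 fun g => ?_
  change Measurable fun ω => ∃ i, i ≤ n ∧ walk i ω = g
  refine Measurable.exists fun i => measurable_const.and ?_
  exact (Measurable.of_discrete (f := fun a : G => a = g)).comp (measurable_walk i)

theorem measurable_totalRange : Measurable (totalRange : (ℕ → G) → Set G) := by
  refine measurable_set_iff.2 fun g => ?_
  simp only [totalRange, Set.mem_iUnion]
  exact Measurable.exists fun n => measurable_set_iff.1 (measurable_range n) g

omit [Group G] [Countable G] [DiscreteMeasurableSpace G] in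
theorem measurable_finset_prod {Ω : Type*} {mΩ : MeasurableSpace Ω} {f : Ω → Finset G × G}
    (hf : Measurable fun ω => (((f ω).1 : Set G), (f ω).2)) : Measurable f :=
  Measurable.prodMk (measurable_finset_iff_measurable_set.2 hf.fst) hf.snd

theorem measurable_stage (n : ℕ) : Measurable (stage n : (ℕ → G) → Finset G × G) := by
  refine measurable_finset_prod ?_
  simp only [stage, coe_finRange]
  exact (measurable_range n).prodMk (measurable_walk n)

theorem measurable_revisited {k : ℕ} {T : (ℕ → G) → Set G} (hT : Measurable T) :
    Measurable fun ω => revisited (increments k ω) (T ω) := by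
  refine measurable_finset_iff.2 fun i => ?_
  simp only [revisited, Finset.mem_filter, Finset.mem_univ, true_and]
  refine Measurable.exists fun a => (measurable_set_iff.1 hT a).and ?_
  exact (Measurable.of_discrete (f := fun x : Fin k → G =>
    walk k (prolong x) * a = walk i (prolong x))).comp (measurable_increments k)

theorem measurable_visitCode (k m : ℕ) :
    Measurable (visitCode k m : (ℕ → G) → (Fin k → G) × Finset (Fin k)) := by
  have hs : Measurable (shift^[k] : (ℕ → G) → ℕ → G) :=
    measurable_pi_lambda _ fun n => by simpa only [shift_iterate] using measurable_pi_apply (n + k)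
  exact (measurable_increments k).prodMk (measurable_revisited ((measurable_range m).comp hs))

theorem measurable_totalVisitCode (k : ℕ) :
    Measurable (totalVisitCode k : (ℕ → G) → (Fin k → G) × Finset (Fin k)) := by
  have hs : Measurable (shift^[k] : (ℕ → G) → ℕ → G) :=
    measurable_pi_lambda _ fun n => by simpa only [shift_iterate] using measurable_pi_apply (n + k)
  exact (measurable_increments k).prodMk (measurable_revisited (measurable_totalRange.comp hs))

theorem indepFun_visitCode_stage_shift_iterate (μ : Measure G) [IsProbabilityMeasure μ] (k m : ℕ) :
    IndepFun (fun ω => (visitCode k m ω, stage (k + m) ω))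
      (shift^[k + m] : (ℕ → G) → ℕ → G) (law μ) := by
  have h := (indepFun_increments_shift_iterate μ (k + m)).comp (ψ := id)
    (φ := fun x => (visitCode k m (prolong x), stage (k + m) (prolong x)))
    .of_discrete measurable_id
  have heq : (fun ω : ℕ → G => (visitCode k m ω, stage (k + m) ω)) =
      (fun x => (visitCode k m (prolong x), stage (k + m) (prolong x))) ∘ increments (k + m) := by
    funext ω
    have hω : ∀ i < k + m, prolong (increments (k + m) ω) i = ω i :=
      fun i hi => prolong_increments hi ω
    simp only [Function.comp_apply, visitCode_congr hω, stage_congr hω]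
  rw [heq]
  exact h

/-! ### The tail σ-algebra -/

omit [Countable G] [DiscreteMeasurableSpace G] in
theorem futureSigma_antitone : Antitone (futureSigma G) :=
  fun _ _ hab => iSup₂_mono' fun j hj => ⟨j, le_trans hab hj, le_rfl⟩

theorem futureSigma_le (n : ℕ) : futureSigma G n ≤ MeasurableSpace.pi :=
  iSup₂_le fun j _ => ((measurable_range j).prodMk (measurable_walk j)).comap_le

theorem tailSigma_le : tailSigma G ≤ MeasurableSpace.pi :=
  (iInf_le _ 0).trans (futureSigma_le 0)

omit [Countable G] [DiscreteMeasurableSpace G] in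
theorem measurable_futureSigma_pair {n j : ℕ} (h : n ≤ j) :
    Measurable[futureSigma G n] fun ω : ℕ → G => (range j ω, walk j ω) :=
  Measurable.mono (comap_measurable _) (le_iSup₂_of_le (f := fun k (_ : k ≥ n) =>
    MeasurableSpace.comap (fun ω : ℕ → G => (range k ω, walk k ω)) inferInstance) j h le_rfl) le_rfl

omit [Countable G] [DiscreteMeasurableSpace G] in
theorem measurable_futureSigma_stage (n : ℕ) :
    Measurable[futureSigma G n] (stage n : (ℕ → G) → Finset G × G) := by
  refine measurable_finset_prod (mΩ := futureSigma G n) ?_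
  simp only [stage, coe_finRange]
  exact measurable_futureSigma_pair le_rfl

/-- The pairs `(R j, S j)` with `j ≥ n` are functions of `(R n, S n)` and of the increments after
time `n`. -/
theorem futureSigma_le_comap (n : ℕ) : futureSigma G n ≤
    MeasurableSpace.comap (fun ω : ℕ → G => (stage n ω, shift^[n] ω)) inferInstance := by
  refine iSup₂_le fun j hj => ?_
  obtain ⟨m, rfl⟩ := Nat.exists_eq_add_of_le hj
  let ψ : (Finset G × G) × (ℕ → G) → Set G × G := fun p =>
    ({g | g ∈ p.1.1 ∨ ∃ a, a ∈ range m p.2 ∧ p.1.2 * a = g}, p.1.2 * walk m p.2)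
  have hψ : Measurable ψ := by
    refine Measurable.prodMk (measurable_set_iff.2 fun g => ?_) ?_
    · refine Measurable.or ?_ (Measurable.exists fun a => Measurable.and ?_ ?_)
      · exact (measurable_finset_mem g).comp (measurable_fst.comp measurable_fst)
      · exact (measurable_set_iff.1 (measurable_range m) a).comp measurable_snd
      · exact (Measurable.of_discrete (f := fun s : G => s * a = g)).comp
          (measurable_snd.comp measurable_fst)
    · exact (Measurable.of_discrete (f := fun p : G × G => p.1 * p.2)).comp
        ((measurable_snd.comp measurable_fst).prodMk ((measurable_walk m).comp measurable_snd))
  have heq : (fun ω : ℕ → G => (range (n + m) ω, walk (n + m) ω)) =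
      ψ ∘ fun ω => (stage n ω, shift^[n] ω) := by
    funext ω
    refine Prod.ext (Set.ext fun g => ?_) (walk_add n m ω)
    change g ∈ range (n + m) ω ↔
      g ∈ finRange n ω ∨ ∃ a, a ∈ range m (shift^[n] ω) ∧ walk n ω * a = g
    rw [← Finset.mem_coe, coe_finRange]
    constructor
    · rintro ⟨i, hi, h⟩
      rcases le_total i n with hin | hin
      · exact Or.inl ⟨i, hin, h⟩
      · refine Or.inr ⟨walk (i - n) (shift^[n] ω), ⟨i - n, by omega, rfl⟩, ?_⟩
        rw [← walk_add, Nat.add_sub_cancel' hin, h]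
    · rintro (⟨i, hi, h⟩ | ⟨a, ⟨i, hi, rfl⟩, h⟩)
      · exact ⟨i, by omega, h⟩
      · exact ⟨n + i, by omega, by rw [walk_add, h]⟩
  rw [heq]
  exact (hψ.comp (comap_measurable _)).comap_le

omit [Countable G] [DiscreteMeasurableSpace G] in
/-- The total range is a tail random set. -/
theorem measurableSet_tailSigma_mem_totalRange (g : G) :
    MeasurableSet[tailSigma G] {ω : ℕ → G | g ∈ totalRange ω} := by
  rw [MeasurableSpace.measurableSet_iInf]
  intro n
  have h : {ω : ℕ → G | g ∈ totalRange ω} = ⋃ j, {ω | g ∈ range (n + j) ω} := by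
    ext ω
    simp only [totalRange, Set.mem_ofPred_eq, Set.mem_iUnion]
    exact ⟨fun ⟨j, hj⟩ => ⟨j, range_mono ω (Nat.le_add_left j n) hj⟩, fun ⟨j, hj⟩ => ⟨n + j, hj⟩⟩
  rw [h]
  refine MeasurableSet.iUnion fun j => ?_
  have hm := measurable_fst.comp (measurable_futureSigma_pair (G := G) (Nat.le_add_right n j))
  exact hm (measurableSet_mem g)

omit [Countable G] [DiscreteMeasurableSpace G] in
theorem iInf_futureSigma_add (k : ℕ) : ⨅ m, futureSigma G (k + m) = tailSigma G := by
  simp_rw [add_comm k]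
  exact futureSigma_antitone.iInf_nat_add k

/-- Under the conditional law given the tail σ-algebra, the total range is almost surely
constant. -/
theorem ae_condExpKernel_totalRange_eq (μ : Measure G) [IsProbabilityMeasure μ] :
    ∀ᵐ ω ∂(law μ), ∀ᵐ ω' ∂(condExpKernel (law μ) (tailSigma G) ω),
      totalRange ω' = totalRange ω := by
  have h : ∀ g : G, ∀ᵐ ω ∂(law μ), ∀ᵐ ω' ∂(condExpKernel (law μ) (tailSigma G) ω),
      (g ∈ totalRange ω' ↔ g ∈ totalRange ω) := by
    intro g
    have hA := measurableSet_tailSigma_mem_totalRange g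
    have hA0 := tailSigma_le _ hA
    set A := {ω : ℕ → G | g ∈ totalRange ω} with hAdef
    have h1 := condExpKernel_ae_eq_condExp (μ := law μ) tailSigma_le hA0
    have h2 : (law μ)⟦A | tailSigma G⟧ = A.indicator fun _ => (1 : ℝ) :=
      condExp_of_stronglyMeasurable tailSigma_le
        (stronglyMeasurable_const.indicator hA) ((integrable_const 1).indicator hA0)
    filter_upwards [h1] with ω hω
    rw [h2] at hω
    by_cases hgω : ω ∈ A
    · rw [Set.indicator_of_mem hgω] at hω
      have hc : (condExpKernel (law μ) (tailSigma G) ω) Aᶜ = 0 := by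
        rw [prob_compl_eq_zero_iff hA0, ← ofReal_measureReal, hω, ENNReal.ofReal_one]
      filter_upwards [measure_eq_zero_iff_ae_notMem.1 hc] with ω' hω'
      exact iff_of_true (not_not.1 hω') hgω
    · rw [Set.indicator_of_notMem hgω] at hω
      have hc : (condExpKernel (law μ) (tailSigma G) ω) A = 0 := by
        rw [← ofReal_measureReal, hω, ENNReal.ofReal_zero]
      filter_upwards [measure_eq_zero_iff_ae_notMem.1 hc] with ω' hω'
      exact iff_of_false hω' hgω
  filter_upwards [ae_all_iff.2 h] with ω hω
  filter_upwards [ae_all_iff.2 hω] with ω' hω' using Set.ext hω'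

end Law

/-! ### Sequences with convergent increments -/

section Sequences

/-- If the increments `u (n + 1) - u n` converge to `l`, then `u n / n` converges to `l`. -/
theorem tendsto_div_of_tendsto_sub {u : ℕ → ℝ} {l : ℝ}
    (h : Tendsto (fun n => u (n + 1) - u n) atTop (𝓝 l)) :
    Tendsto (fun n => u n / n) atTop (𝓝 l) := by
  have h0 : Tendsto (fun n : ℕ => u 0 / n) atTop (𝓝 0) := tendsto_const_div_atTop_nhds_zero_nat _
  have h1 := h.cesaro.add h0
  rw [add_zero] at h1
  refine h1.congr fun n => ?_
  rw [Finset.sum_range_sub]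
  ring

theorem tendsto_sub_of_tendsto_sub {u : ℕ → ℝ} {l : ℝ}
    (h : Tendsto (fun n => u (n + 1) - u n) atTop (𝓝 l)) (k : ℕ) :
    Tendsto (fun n => u (k + n) - u n) atTop (𝓝 (k * l)) := by
  induction k with
  | zero => simp
  | succ k ih =>
    have h1 : Tendsto (fun n => u (k + n + 1) - u (k + n)) atTop (𝓝 l) :=
      h.comp (tendsto_atTop_mono (fun n => Nat.le_add_left n k) tendsto_id)
    have h2 := h1.add ih
    rw [show l + (k : ℝ) * l = ((k + 1 : ℕ) : ℝ) * l by push_cast; ring] at h2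
    refine h2.congr fun n => ?_
    rw [show k + 1 + n = k + n + 1 by omega]
    ring

theorem tendsto_log_succ_div :
    Tendsto (fun n : ℕ => Real.log (n + 1 : ℕ) / n) atTop (𝓝 0) := by
  have h := (Real.tendsto_pow_log_div_mul_add_atTop 1 (-1) 1 one_ne_zero).comp
    (tendsto_natCast_atTop_atTop.comp (tendsto_add_atTop_nat 1))
  refine h.congr fun n => ?_
  simp

end Sequences

/-! ### Entropy of the range -/

section RangeEntropyFormula

variable {G : Type*} [Group G] [Countable G] [MeasurableSpace G] [DiscreteMeasurableSpace G]
  (μ : Measure G) [IsProbabilityMeasure μ]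

theorem entropy_increments_lt_top (hfin : entropy (law μ) (fun ω : ℕ → G => ω 0) < ∞) (k : ℕ) :
    entropy (law μ) (increments (G := G) k) < ∞ := by
  induction k with
  | zero =>
    rw [entropy_of_countable, tsum_eq_single default fun b hb => absurd (Subsingleton.elim _ _) hb]
    exact ENNReal.ofReal_lt_top
  | succ k ih =>
    have h : entropy (law μ) (increments (G := G) (k + 1)) =
        entropy (law μ) fun ω : ℕ → G => (increments k ω, shift^[k] ω 0) := by
      refine entropy_eq_of_forall_eq_iff fun ω ω' => ?_
      simp only [Prod.mk.injEq, shift_iterate, zero_add, funext_iff, increments]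
      constructor
      · rintro ⟨h1, h2⟩ i
        rcases Nat.lt_succ_iff_lt_or_eq.1 i.2 with hi | hi
        · exact h1 ⟨i, hi⟩
        · rw [hi, h2]
      · exact fun h => ⟨fun i => h i.castSucc, h (Fin.last k)⟩
    have h0 : Measurable fun ω : ℕ → G => ω 0 := measurable_pi_apply 0
    have hT := measurePreserving_shift_iterate μ k
    have h0T : Measurable fun ω : ℕ → G => shift^[k] ω 0 := h0.comp hT.measurable
    rw [h, entropy_prod_of_indepFun (measurable_increments k) h0T
      ((indepFun_increments_shift_iterate μ k).comp (φ := id) measurable_id h0),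
      entropy_comp_measurePreserving hT h0]
    exact ENNReal.add_lt_top.2 ⟨ih, hfin⟩

theorem entropy_stage_lt_top (hfin : entropy (law μ) (fun ω : ℕ → G => ω 0) < ∞) (n : ℕ) :
    entropy (law μ) (stage (G := G) n) < ∞ := by
  have h : stage n = fun ω : ℕ → G => (fun x => stage n (prolong x)) (increments n ω) :=
    funext fun ω => stage_congr fun i hi => (prolong_increments hi ω).symm
  rw [h]
  exact (entropy_comp_le (measurable_increments n) fun x => stage n (prolong x)).trans_lt
    (entropy_increments_lt_top μ hfin n)

omit [DiscreteMeasurableSpace G] in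
theorem entropy_range_eq (n : ℕ) :
    entropy (law μ) (range (G := G) n) = entropy (law μ) (finRange (G := G) n) :=
  entropy_eq_of_forall_eq_iff fun _ _ => finRange_eq_iff

theorem entropy_range_le_entropy_stage (n : ℕ) :
    entropy (law μ) (range (G := G) n) ≤ entropy (law μ) (stage (G := G) n) := by
  rw [entropy_range_eq]
  exact entropy_comp_le (measurable_stage n) Prod.fst

/-- The endpoint `S n` lies in `R n`, so it adds at most `ln (n + 1)` to the entropy. -/
theorem entropy_stage_le (n : ℕ) : entropy (law μ) (stage (G := G) n) ≤
    entropy (law μ) (range (G := G) n) + ENNReal.ofReal (Real.log (n + 1 : ℕ)) := by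
  have h : entropy (law μ) (stage (G := G) n) =
      entropy (law μ) fun ω : ℕ → G => (walk n ω, finRange n ω) :=
    entropy_eq_of_forall_eq_iff fun ω ω' => by simp only [stage, Prod.mk.injEq, and_comm]
  rw [h, entropy_range_eq]
  exact entropy_prod_le_add_log (measurable_walk n) (measurable_stage n).fst id
    (walk_mem_finRange n) n.succ_pos (card_finRange_le n)

/-- The contribution of the value `y` to `H(X_1, …, X_k, R_m ∘ θ^k | R_{k+m}, S_{k+m})`. -/
noncomputable def stageTerm (k m : ℕ) (y : (Fin k → G) × Finset (Fin k)) : ℝ :=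
  ∫ ω, Real.negMulLog (((law μ)⟦visitCode k m ⁻¹' {y} | futureSigma G (k + m)⟧) ω) ∂(law μ)

/-- The contribution of the value `y` to `H(X_1, …, X_k, R_∞ ∘ θ^k | 𝒢_∞)`. -/
noncomputable def tailTerm (k : ℕ) (y : (Fin k → G) × Finset (Fin k)) : ℝ :=
  ∫ ω, Real.negMulLog (((law μ)⟦totalVisitCode k ⁻¹' {y} | tailSigma G⟧) ω) ∂(law μ)

/-- A summable bound for `stageTerm` and `tailTerm`, uniform in `m`. -/
noncomputable def termBound (k : ℕ) (y : (Fin k → G) × Finset (Fin k)) : ℝ :=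
  Real.negMulLog ((law μ).real (increments k ⁻¹' {y.1})) + (law μ).real (increments k ⁻¹' {y.1})

theorem summable_termBound (hfin : entropy (law μ) (fun ω : ℕ → G => ω 0) < ∞) (k : ℕ) :
    Summable (termBound μ k) := by
  have hent := (entropy_increments_lt_top μ hfin k).ne
  rw [entropy_of_countable] at hent
  have hn : ∀ x, 0 ≤ Real.negMulLog ((law μ).real (increments k ⁻¹' {x})) := fun x =>
    Real.negMulLog_nonneg measureReal_nonneg measureReal_le_one
  have h1 : Summable fun x => Real.negMulLog ((law μ).real (increments k ⁻¹' {x})) := by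
    simpa only [ENNReal.toReal_ofReal (hn _)] using ENNReal.summable_toReal hent
  have h2 : Summable fun x => (law μ).real (increments k ⁻¹' {x}) := by
    refine ENNReal.summable_toReal (f := fun x => (law μ) (increments k ⁻¹' {x})) ?_
    have := lintegral_comp_discrete (P := law μ) (measurable_increments k) fun _ => 1
    simp only [lintegral_const, one_mul, measure_univ] at this
    rw [← this]
    exact ENNReal.one_ne_top
  have h3 : Summable fun _ : Finset (Fin k) => (1 : ℝ) := (hasSum_fintype _).summable
  have h4 := (h1.add h2).mul_of_nonneg h3 (fun x => add_nonneg (hn x) measureReal_nonneg)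
    fun _ => zero_le_one
  simp only [mul_one] at h4
  exact h4

theorem stageTerm_nonneg (k m : ℕ) (y : (Fin k → G) × Finset (Fin k)) : 0 ≤ stageTerm μ k m y :=
  integral_negMulLog_condExp_nonneg (futureSigma_le _)
    (measurable_visitCode k m (MeasurableSet.singleton y))

theorem tailTerm_nonneg (k : ℕ) (y : (Fin k → G) × Finset (Fin k)) : 0 ≤ tailTerm μ k y :=
  integral_negMulLog_condExp_nonneg tailSigma_le
    (measurable_totalVisitCode k (MeasurableSet.singleton y))

theorem stageTerm_le (k m : ℕ) (y : (Fin k → G) × Finset (Fin k)) :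
    stageTerm μ k m y ≤ termBound μ k y := by
  refine integral_negMulLog_condExp_le (futureSigma_le _)
    (measurable_visitCode k m (MeasurableSet.singleton y)) (measureReal_mono ?_) measureReal_le_one
  intro ω (hω : visitCode k m ω = y)
  rw [← hω]
  rfl

theorem tailTerm_le (k : ℕ) (y : (Fin k → G) × Finset (Fin k)) :
    tailTerm μ k y ≤ termBound μ k y := by
  refine integral_negMulLog_condExp_le tailSigma_le
    (measurable_totalVisitCode k (MeasurableSet.singleton y)) (measureReal_mono ?_)
    measureReal_le_one
  intro ω (hω : totalVisitCode k ω = y)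
  rw [← hω]
  rfl

theorem summable_stageTerm (hfin : entropy (law μ) (fun ω : ℕ → G => ω 0) < ∞) (k m : ℕ) :
    Summable (stageTerm μ k m) :=
  (summable_termBound μ hfin k).of_nonneg_of_le (stageTerm_nonneg μ k m) (stageTerm_le μ k m)

theorem summable_tailTerm (hfin : entropy (law μ) (fun ω : ℕ → G => ω 0) < ∞) (k : ℕ) :
    Summable (tailTerm μ k) :=
  (summable_termBound μ hfin k).of_nonneg_of_le (tailTerm_nonneg μ k) (tailTerm_le μ k)

theorem tendsto_stageTerm (k : ℕ) (y : (Fin k → G) × Finset (Fin k)) :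
    Tendsto (fun m => stageTerm μ k m y) atTop (𝓝 (tailTerm μ k y)) := by
  have hanti : Antitone fun m => futureSigma G (k + m) := fun a b hab =>
    futureSigma_antitone (Nat.add_le_add_left hab k)
  have h := tendsto_integral_negMulLog_condExp (P := law μ) hanti (fun m => futureSigma_le _)
    (fun m => measurable_visitCode k m (MeasurableSet.singleton y))
    (measurable_totalVisitCode k (MeasurableSet.singleton y)) fun ω => by
      filter_upwards [eventually_visitCode_eq k ω] with m hm
      simp only [Set.mem_preimage, hm]
  rw [iInf_futureSigma_add] at h
  exact h

theorem tendsto_tsum_stageTerm (hfin : entropy (law μ) (fun ω : ℕ → G => ω 0) < ∞) (k : ℕ) :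
    Tendsto (fun m => ∑' y, stageTerm μ k m y) atTop (𝓝 (∑' y, tailTerm μ k y)) := by
  refine tendsto_tsum_of_dominated_convergence (summable_termBound μ hfin k)
    (tendsto_stageTerm μ k) (Eventually.of_forall fun m y => ?_)
  rw [Real.norm_of_nonneg (stageTerm_nonneg μ k m y)]
  exact stageTerm_le μ k m y

theorem condEntropy_eq_tsum (k : ℕ) :
    condEntropy (tailSigma G) (law μ)
        (fun ω : ℕ → G => (increments k ω, totalRange (shift^[k] ω))) =
      ∑' y, ENNReal.ofReal (tailTerm μ k y) := by
  -- Given `R_∞ = R`, the pair `(X_1, …, X_k, R_∞ ∘ θ^k)` is a function of `totalVisitCode k`.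
  have h1 : ∀ᵐ ω ∂(law μ), entropy (condExpKernel (law μ) (tailSigma G) ω)
      (fun ω : ℕ → G => (increments k ω, totalRange (shift^[k] ω))) =
      ∑' y, ENNReal.ofReal (Real.negMulLog
        ((condExpKernel (law μ) (tailSigma G) ω).real (totalVisitCode k ⁻¹' {y}))) := by
    filter_upwards [ae_condExpKernel_totalRange_eq μ] with ω hω
    rw [← entropy_of_countable]
    refine entropy_eq_of_recoding (fun y => (y.1, recover y.1 y.2 (totalRange ω)))
      (fun z => (z.1, revisited z.1 z.2)) (fun _ => rfl) ?_
    filter_upwards [hω] with ω' hω'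
    simp only [totalVisitCode, ← hω', totalRange_eq_assemble k ω', recover_revisited_assemble]
  have hA : ∀ y, MeasurableSet (totalVisitCode k ⁻¹' {y} : Set (ℕ → G)) := fun y =>
    measurable_totalVisitCode k (MeasurableSet.singleton y)
  have h2 := fun y => condExpKernel_ae_eq_condExp (μ := law μ) tailSigma_le (hA y)
  rw [condEntropy, lintegral_congr_ae h1, lintegral_tsum]
  · refine tsum_congr fun y => ?_
    rw [tailTerm, ofReal_integral_eq_lintegral_ofReal
      (integrable_negMulLog_condExp tailSigma_le (hA y))]
    · refine lintegral_congr_ae ?_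
      filter_upwards [h2 y] with ω hω
      rw [hω]
    · filter_upwards [condExp_indicator_mem_Icc (P := law μ) tailSigma_le (hA y)] with ω hω using
        Real.negMulLog_nonneg hω.1 hω.2
  · intro y
    have hm := (measurable_condExpKernel (μ := law μ) (m := tailSigma G) (hA y)).mono
      tailSigma_le le_rfl
    exact (ENNReal.measurable_ofReal.comp
      (Real.continuous_negMulLog.measurable.comp hm.ennreal_toReal)).aemeasurable

/-- The entropy of `(X_1, …, X_k, R_m ∘ θ^k, S_m ∘ θ^k)` computed in two ways: by independence and
stationarity, and by conditioning on `(R_{k+m}, S_{k+m})`. -/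
theorem entropy_increments_add_entropy_stage (k m : ℕ) :
    entropy (law μ) (increments (G := G) k) + entropy (law μ) (stage (G := G) m) =
      entropy (law μ) (stage (G := G) (k + m)) + ∑' y, ENNReal.ofReal (stageTerm μ k m y) := by
  have hT := measurePreserving_shift_iterate μ k
  have hA : ∀ y, MeasurableSet (visitCode k m ⁻¹' {y} : Set (ℕ → G)) := fun y =>
    measurable_visitCode k m (MeasurableSet.singleton y)
  calc entropy (law μ) (increments (G := G) k) + entropy (law μ) (stage (G := G) m)
      = entropy (law μ) fun ω : ℕ → G => (increments k ω, stage m (shift^[k] ω)) := by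
        have hmT : Measurable fun ω : ℕ → G => stage m (shift^[k] ω) :=
          (measurable_stage m).comp hT.measurable
        rw [entropy_prod_of_indepFun (measurable_increments k) hmT
          ((indepFun_increments_shift_iterate μ k).comp (φ := id) measurable_id
            (measurable_stage m)),
          entropy_comp_measurePreserving hT (measurable_stage m)]
    _ = entropy (law μ) fun ω : ℕ → G => (visitCode k m ω, stage (k + m) ω) :=
        entropy_eq_of_forall_eq_iff (visitCode_stage_eq_iff k m)
    _ = _ := by
        rw [entropy_prod_eq_add (measurable_visitCode k m) (measurable_stage (k + m))]
        congr 1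
        refine tsum_congr fun y => ?_
        have hM := condProb_ae_eq_condExp (measurable_visitCode k m) (measurable_stage (k + m))
          (measurePreserving_shift_iterate μ (k + m)).measurable
          (indepFun_visitCode_stage_shift_iterate μ k m) (measurable_futureSigma_stage (k + m))
          (futureSigma_le_comap (k + m)) y
        rw [stageTerm, ofReal_integral_eq_lintegral_ofReal
          (integrable_negMulLog_condExp (futureSigma_le _) (hA y))]
        · refine lintegral_congr_ae ?_
          filter_upwards [hM] with ω hω
          rw [hω]
        · filter_upwards [condExp_indicator_mem_Icc (P := law μ) (futureSigma_le (k + m)) (hA y)]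
            with ω hω using Real.negMulLog_nonneg hω.1 hω.2

theorem tendsto_entropy_stage_sub (hfin : entropy (law μ) (fun ω : ℕ → G => ω 0) < ∞) (k : ℕ) :
    Tendsto (fun m => (entropy (law μ) (stage (G := G) (k + m))).toReal -
        (entropy (law μ) (stage (G := G) m)).toReal) atTop
      (𝓝 ((entropy (law μ) (increments (G := G) k)).toReal - ∑' y, tailTerm μ k y)) := by
  refine ((tendsto_tsum_stageTerm μ hfin k).const_sub _).congr fun m => ?_
  have h := congrArg ENNReal.toReal (entropy_increments_add_entropy_stage μ k m)
  rw [← ENNReal.ofReal_tsum_of_nonneg (stageTerm_nonneg μ k m) (summable_stageTerm μ hfin k m),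
    ENNReal.toReal_add (entropy_increments_lt_top μ hfin k).ne (entropy_stage_lt_top μ hfin m).ne,
    ENNReal.toReal_add (entropy_stage_lt_top μ hfin _).ne ENNReal.ofReal_ne_top,
    ENNReal.toReal_ofReal (tsum_nonneg (stageTerm_nonneg μ k m))] at h
  linarith

theorem tendsto_entropy_range_div (hfin : entropy (law μ) (fun ω : ℕ → G => ω 0) < ∞) :
    Tendsto (fun n : ℕ => (entropy (law μ) (range (G := G) n)).toReal / n) atTop
      (𝓝 ((entropy (law μ) (increments (G := G) 1)).toReal - ∑' y, tailTerm μ 1 y)) := by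
  have hS : ∀ n, entropy (law μ) (stage (G := G) n) ≠ ∞ := fun n =>
    (entropy_stage_lt_top μ hfin n).ne
  have hR : ∀ n, entropy (law μ) (range (G := G) n) ≠ ∞ := fun n =>
    ((entropy_range_le_entropy_stage μ n).trans_lt (entropy_stage_lt_top μ hfin n)).ne
  have h1 := tendsto_div_of_tendsto_sub
    (u := fun n => (entropy (law μ) (stage (G := G) n)).toReal)
    (by simpa only [add_comm 1] using tendsto_entropy_stage_sub μ hfin 1)
  have h2 := h1.sub tendsto_log_succ_div
  rw [sub_zero] at h2
  refine tendsto_of_tendsto_of_tendsto_of_le_of_le h2 h1 (fun n => ?_) fun n => ?_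
  · have h := ENNReal.toReal_mono (ENNReal.add_ne_top.2 ⟨hR n, ENNReal.ofReal_ne_top⟩)
      (entropy_stage_le μ n)
    rw [ENNReal.toReal_add (hR n) ENNReal.ofReal_ne_top,
      ENNReal.toReal_ofReal (Real.log_natCast_nonneg _)] at h
    dsimp only
    rw [← sub_div]
    gcongr
    linarith
  · dsimp only
    gcongr
    · exact hS n
    · exact entropy_range_le_entropy_stage μ n

theorem avgRangeEntropy_eq (hfin : entropy (law μ) (fun ω : ℕ → G => ω 0) < ∞) :
    avgRangeEntropy μ =
      (entropy (law μ) (increments (G := G) 1)).toReal - ∑' y, tailTerm μ 1 y :=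
  (tendsto_entropy_range_div μ hfin).limUnder_eq

theorem natCast_mul_avgRangeEntropy (hfin : entropy (law μ) (fun ω : ℕ → G => ω 0) < ∞) (k : ℕ) :
    k * avgRangeEntropy μ =
      (entropy (law μ) (increments (G := G) k)).toReal - ∑' y, tailTerm μ k y := by
  have h1 := tendsto_sub_of_tendsto_sub
    (u := fun n => (entropy (law μ) (stage (G := G) n)).toReal)
    (by simpa only [add_comm 1] using tendsto_entropy_stage_sub μ hfin 1) k
  rw [avgRangeEntropy_eq μ hfin]
  exact tendsto_nhds_unique h1 (tendsto_entropy_stage_sub μ hfin k)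

end RangeEntropyFormula

end RangeEntropy

theorem theorem1p4 {G : Type*} [Group G] [Countable G] [MeasurableSpace G]
    [DiscreteMeasurableSpace G] (μ : Measure G) [IsProbabilityMeasure μ]
    (hgen : Subgroup.closure {g : G | μ {g} ≠ 0} = ⊤)
    (hpos : 0 < RangeEntropy.entropy (RangeEntropy.law μ) (fun ω : ℕ → G => ω 0))
    (hfin : RangeEntropy.entropy (RangeEntropy.law μ) (fun ω : ℕ → G => ω 0) < ∞) :
    -- the limit defining `h_R(μ)` exists
    ((∀ n : ℕ, RangeEntropy.entropy (RangeEntropy.law μ) (RangeEntropy.range (G := G) n) < ∞) ∧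
      Tendsto (fun n : ℕ =>
        (RangeEntropy.entropy (RangeEntropy.law μ) (RangeEntropy.range (G := G) n)).toReal / n)
        atTop (𝓝 (RangeEntropy.avgRangeEntropy μ))) ∧
    -- the entropy formula, with both entropies finite
    ∀ k : ℕ, 1 ≤ k →
      RangeEntropy.entropy (RangeEntropy.law μ) (RangeEntropy.increments (G := G) k) < ∞ ∧
      RangeEntropy.condEntropy (RangeEntropy.tailSigma G) (RangeEntropy.law μ)
        (fun ω : ℕ → G => (RangeEntropy.increments k ω,
          RangeEntropy.totalRange (RangeEntropy.shift^[k] ω))) < ∞ ∧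
      RangeEntropy.avgRangeEntropy μ =
        (1 / (k : ℝ)) *
          ((RangeEntropy.entropy (RangeEntropy.law μ)
              (RangeEntropy.increments (G := G) k)).toReal -
            (RangeEntropy.condEntropy (RangeEntropy.tailSigma G) (RangeEntropy.law μ)
              (fun ω : ℕ → G => (RangeEntropy.increments k ω,
                RangeEntropy.totalRange (RangeEntropy.shift^[k] ω)))).toReal) := by
  refine ⟨⟨fun n => (RangeEntropy.entropy_range_le_entropy_stage μ n).trans_lt
    (RangeEntropy.entropy_stage_lt_top μ hfin n), ?_⟩, fun k hk => ?_⟩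
  · rw [RangeEntropy.avgRangeEntropy_eq μ hfin]
    exact RangeEntropy.tendsto_entropy_range_div μ hfin
  have hC := RangeEntropy.condEntropy_eq_tsum μ k
  rw [← ENNReal.ofReal_tsum_of_nonneg (RangeEntropy.tailTerm_nonneg μ k)
    (RangeEntropy.summable_tailTerm μ hfin k)] at hC
  refine ⟨RangeEntropy.entropy_increments_lt_top μ hfin k, hC ▸ ENNReal.ofReal_lt_top, ?_⟩
  have hk0 : (k : ℝ) ≠ 0 := Nat.cast_ne_zero.2 (Nat.one_le_iff_ne_zero.1 hk)
  rw [hC, ENNReal.toReal_ofReal (tsum_nonneg (RangeEntropy.tailTerm_nonneg μ k)),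
    ← RangeEntropy.natCast_mul_avgRangeEntropy μ hfin k]
  field_simp
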